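/- Let $n\ge 2$, $\mathcal N=\{1,\dots,n\}$, and let $\mathcal H_n=\mathbb R^{2^{\mathcal N}}$ be the space of real-valued functions on the subsets of $\mathcal N$, with its Euclidean topology. Fix a base $b>1$ for the logarithm in the Shannon entropy $H$. Let $\Gamma^*_n\subset\mathcal H_n$ be the set of all entropy functions $\mathbf h(\mathcal A)=H(X_{\mathcal A})$, $\mathcal A\subset\mathcal N$, of $n$ jointly distributed discrete random variables $X_1,\dots,X_n$ with finite entropy, where $X_{\mathcal A}=(X_i)_{i\in\mathcal A}$. Let $\Gamma_n\subset\mathcal H_n$ be the set of all polymatroids, i.e. of all $\mathbf h$ with $\mathbf h(\emptyset)=0$, $\mathbf h(\mathcal A)\le\mathbf h(\mathcal B)$ whenever $\mathcal A\subset\mathcal B\subset\mathcal N$, and $\mathbf h(\mathcal A)+\mathbf h(\mathcal B)\ge\mathbf h(\mathcal A\cap\mathcal B)+\mathbf h(\mathcal A\cup\mathcal B)$ for all $\mathcal A,\mathcal B\subset\mathcal N$. For the partition $[1,n-1]=\{\mathcal N_1,\mathcal N_2\}$ of $\mathcal N$ with $\mathcal N_1=\{1\}$ and $\mathcal N_2=\{2,\dots,n\}$,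 let $S_{1,n-1}$ be the subspace of all $\mathbf h\in\mathcal H_n$ such that $\mathbf h(\mathcal A)=\mathbf h(\mathcal B)$ whenever $|\mathcal A\cap\mathcal N_i|=|\mathcal B\cap\mathcal N_i|$ for $i=1,2$, and put $\Psi^*_{1,n-1}=\Gamma^*_n\cap S_{1,n-1}$ and $\Psi_{1,n-1}=\Gamma_n\cap S_{1,n-1}$. Then $$\Psi_{1,n-1}=\overline{\Gamma^*_n}\cap S_{1,n-1}\qquad\text{and}\qquad \overline{\Psi^*_{1,n-1}}=\Psi_{1,n-1},$$ where the bar denotes topological closure in $\mathcal H_n$. -/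

import Mathlib

open MeasureTheory

namespace PartSymEntropy

/-- The entropy space `ℝ^(2^𝒩)` for the index set `𝒩 = Fin n`
(the paper's index `1` is `0 : Fin n`), with its usual topology. -/
abbrev EntropySpace (n : ℕ) : Type := Finset (Fin n) → ℝ

/-- `c` is the (finite) Shannon entropy, with logarithms to the base `b`, of the random variable `Y`
with values in the countable alphabet `β`: the series `∑ y, -P(Y = y) log_b P(Y = y)`
converges and its sum is `c`. -/
def HasEntropy (b : ℝ) {Ω : Type} [MeasurableSpace Ω] (P : Measure Ω) {β : Type}
    (Y : Ω → β) (c : ℝ) : Prop :=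
  HasSum (fun y : β => -(P.real (Y ⁻¹' {y}) * Real.logb b (P.real (Y ⁻¹' {y})))) c

/-- The subfamily `X_A = (X_i)_{i ∈ A}` of a family of random variables. -/
def subfamily {n : ℕ} {Ω : Type} {α : Fin n → Type} (X : ∀ i, Ω → α i) (A : Finset (Fin n)) :
    Ω → ∀ i : A, α i :=
  fun ω i => X i ω

/-- `h` is entropic: it is the entropy function `A ↦ H(X_A)` of a family of `n` jointly
distributed discrete random variables (each with a countable alphabet). -/
def IsEntropic (b : ℝ) {n : ℕ} (h : EntropySpace n) : Prop :=
  ∃ (Ω : Type) (_ : MeasurableSpace Ω) (P : Measure Ω) (_ : IsProbabilityMeasure P)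
    (α : Fin n → Type) (_ : ∀ i, Countable (α i)) (_ : ∀ i, MeasurableSpace (α i))
    (_ : ∀ i, MeasurableSingletonClass (α i)) (X : ∀ i, Ω → α i),
    (∀ i, Measurable (X i)) ∧ ∀ A : Finset (Fin n), HasEntropy b P (subfamily X A) (h A)

/-- The entropy function region `Γ*_n` (entropies to the base `b`). -/
def entropyRegion (b : ℝ) (n : ℕ) : Set (EntropySpace n) :=
  {h | IsEntropic b h}

/-- The polymatroidal region `Γ_n`. -/
def polymatroidRegion (n : ℕ) : Set (EntropySpace n) :=
  {h | h ∅ = 0 ∧ (∀ A B : Finset (Fin n), A ⊆ B → h A ≤ h B) ∧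
    ∀ A B : Finset (Fin n), h (A ∩ B) + h (A ∪ B) ≤ h A + h B}

/-- The `p`-symmetrical subspace `S_p`, for a partition `p` of the index set. -/
def symSubspace {n : ℕ} (p : Finpartition (Finset.univ : Finset (Fin n))) :
    Submodule ℝ (EntropySpace n) where
  carrier := {h | ∀ A B : Finset (Fin n),
    (∀ N ∈ p.parts, (A ∩ N).card = (B ∩ N).card) → h A = h B}
  zero_mem' := fun _ _ _ => rfl
  add_mem' := fun {f g} hf hg A B hAB => by
    show f A + g A = f B + g B
    rw [hf A B hAB, hg A B hAB]
  smul_mem' := fun c f hf A B hAB => by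
    show c * f A = c * f B
    rw [hf A B hAB]

/-- The `p`-symmetrical entropy function region `Ψ*_p`. -/
def symEntropyRegion (b : ℝ) {n : ℕ} (p : Finpartition (Finset.univ : Finset (Fin n))) :
    Set (EntropySpace n) :=
  entropyRegion b n ∩ symSubspace p

/-- The `p`-symmetrical polymatroidal region `Ψ_p`. -/
def symPolymatroidRegion {n : ℕ} (p : Finpartition (Finset.univ : Finset (Fin n))) :
    Set (EntropySpace n) :=
  polymatroidRegion n ∩ symSubspace p

/-- The partition `[1, n-1]`, that is `{{1}, {2, …, n}}`; both blocks are nonempty as `2 ≤ n`. -/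
def partitionOneRest (n : ℕ) (hn : 2 ≤ n) : Finpartition (Finset.univ : Finset (Fin n)) where
  parts := {{⟨0, by omega⟩}, Finset.univ.erase ⟨0, by omega⟩}
  supIndep := by
    rw [Finset.supIndep_iff_pairwiseDisjoint]
    intro A hA B hB hAB
    simp only [Finset.coe_insert, Finset.coe_singleton, Set.mem_insert_iff,
      Set.mem_singleton_iff] at hA hB
    rcases hA with rfl | rfl <;> rcases hB with rfl | rfl
    · exact absurd rfl hAB
    · simp [Function.onFun]
    · simp [Function.onFun]
    · exact absurd rfl hAB
  sup_parts := by
    ext i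
    simp
  bot_notMem := by
    simp only [Finset.bot_eq_empty, Finset.mem_insert, Finset.mem_singleton, not_or]
    refine ⟨(Finset.singleton_ne_empty _).symm, fun h => ?_⟩
    have h1 : (⟨1, by omega⟩ : Fin n) ∈ (Finset.univ.erase ⟨0, by omega⟩ : Finset (Fin n)) := by
      simp
    rw [← h] at h1
    simp at h1

end PartSymEntropy

/-! Write Ψ, Ψ*, Γ, Γ*, S for the sets in the theorem. Both equalities follow from the cycle Ψ ⊆ cl
Ψ* ⊆ cl Γ* ∩ S ⊆ Ψ. The middle inclusion is formal, and the last is Shannon's inequalities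
(`entropyRegion_subset_polymatroidRegion`) together with closedness of Γ.

For the first inclusion, let z be the singled-out index. A member of Ψ depends only on whether z ∈ A
and on |A \ {z}|. It is therefore encoded by its increments α over sets avoiding z, its increments β
over sets containing z, and the final excess t = h(N) - h(N \ {z}). The polymatroid axioms make α
and β nonincreasing with 0 ≤ β ≤ α, and t ≥ 0. Repeatedly peeling off constant steps writes such
data as a sum of pairs "c on the first k indices, c on the first l indices" with l ≤ k, plus the
pure t part (`profile_mem_closure`).

A step pair is c times the rank function min(|A \ {z}| + (k - l)[z ∈ A], k). A Reed-Solomon code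
over a large prime field realizes this rank when coordinate z carries k - l evaluations
(`hasUniformCode_min`). To reach an arbitrary real multiple c ≥ 0, the code is switched on with
probability δ = c / log_b q. The entropy is then H(δ) + δ ρ(A) log_b q for nonempty A, which tends
to c ρ(A) (`smul_mem_closure_symEntropyRegion`). Independent families add entropies, so cl Ψ* is
closed under sums. -/

namespace PartSymEntropy

/-! ### Entropy as expected information content -/

/-- The information content `-log_b P(Y = Y ω)` of the value of `Y` at `ω`. -/
noncomputable def info (b : ℝ) {Ω : Type} [MeasurableSpace Ω] (P : Measure Ω) {β : Type}
    (Y : Ω → β) (ω : Ω) : ℝ :=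
  -Real.logb b (P.real (Y ⁻¹' {Y ω}))

section
variable {b : ℝ} {Ω : Type} [MeasurableSpace Ω] {P : Measure Ω} [IsProbabilityMeasure P]
  {β : Type} [Countable β] [MeasurableSpace β] [MeasurableSingletonClass β] {Y : Ω → β}

theorem negLogb_measureReal_nonneg (hb : 1 < b) (s : Set Ω) : 0 ≤ -Real.logb b (P.real s) :=
  neg_nonneg.mpr (Real.logb_nonpos hb measureReal_nonneg measureReal_le_one)

/-- The entropy is the expectation of the information content. -/
theorem hasEntropy_iff_integral_info (hb : 1 < b) (hY : Measurable Y) (c : ℝ) :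
    HasEntropy b P Y c ↔ Integrable (info b P Y) P ∧ ∫ ω, info b P Y ω ∂P = c := by
  set g : β → ℝ := fun y => -Real.logb b (P.real (Y ⁻¹' {y})) with hg
  have hg0 : ∀ y, 0 ≤ g y := fun y => negLogb_measureReal_nonneg hb _
  have hgm : Measurable g := measurable_of_countable g
  have hinfo : info b P Y = g ∘ Y := rfl
  have hterm : ∀ y, -(P.real (Y ⁻¹' {y}) * Real.logb b (P.real (Y ⁻¹' {y})))
      = (P.map Y).real {y} * g y := by
    intro y
    rw [map_measureReal_apply hY (measurableSet_singleton y), hg]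
    ring
  have hlin : ∫⁻ y, ENNReal.ofReal (g y) ∂(P.map Y)
      = ∑' y, ENNReal.ofReal ((P.map Y).real {y} * g y) := by
    rw [lintegral_countable']
    refine tsum_congr fun y => ?_
    rw [ENNReal.ofReal_mul measureReal_nonneg, ofReal_measureReal, mul_comm]
  have hint : Integrable (info b P Y) P ↔ Integrable g (P.map Y) := by
    rw [hinfo, integrable_map_measure hgm.aestronglyMeasurable hY.aemeasurable]
  have hval : ∫ ω, info b P Y ω ∂P = ∫ y, g y ∂(P.map Y) := by
    rw [integral_map hY.aemeasurable hgm.aestronglyMeasurable]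
    rfl
  have hn : ∀ y, 0 ≤ (P.map Y).real {y} * g y := fun y => mul_nonneg measureReal_nonneg (hg0 y)
  have hsum : Integrable g (P.map Y) ↔ Summable fun y => (P.map Y).real {y} * g y := by
    constructor
    · intro h
      have h1 := h.lintegral_lt_top
      rw [hlin] at h1
      have h2 := ENNReal.summable_toReal h1.ne
      simpa only [ENNReal.toReal_ofReal (hn _)] using h2
    · intro h
      refine ⟨hgm.aestronglyMeasurable, ?_⟩
      rw [hasFiniteIntegral_iff_ofReal (Filter.Eventually.of_forall hg0), hlin]
      exact h.tsum_ofReal_lt_top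
  rw [hint, hval]
  unfold HasEntropy
  simp_rw [hterm]
  constructor
  · intro h
    have hi := hsum.2 h.summable
    refine ⟨hi, ?_⟩
    rw [integral_countable hi, ← h.tsum_eq]
    rfl
  · rintro ⟨hi, rfl⟩
    rw [integral_countable hi]
    exact (hsum.1 hi).hasSum

-- The alphabet is countable, so the null fibers together form a null set. This keeps the arguments
-- of the logarithms nonzero almost everywhere.
omit [IsProbabilityMeasure P] in
theorem ae_measure_fiber_ne_zero (hY : Measurable Y) : ∀ᵐ ω ∂P, P (Y ⁻¹' {Y ω}) ≠ 0 := by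
  have h : ∀ᵐ y ∂(P.map Y), P (Y ⁻¹' {y}) ≠ 0 := by
    rw [ae_iff_of_countable]
    intro y hy
    rwa [Measure.map_apply hY (measurableSet_singleton y)] at hy
  exact ae_of_ae_map hY.aemeasurable h

omit [IsProbabilityMeasure P] in
theorem lintegral_comp_eq_tsum (hY : Measurable Y) (f : β → ENNReal) :
    ∫⁻ ω, f (Y ω) ∂P = ∑' y, f y * P (Y ⁻¹' {y}) := by
  rw [← lintegral_map (measurable_of_countable f) hY, lintegral_countable']
  exact tsum_congr fun y => by rw [Measure.map_apply hY (measurableSet_singleton y)]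

/-- The conditional mutual information density of `F` and `G` given a common function `φ ∘ F = ψ ∘ G`
has exponential of its negative integrating to at most one. -/
theorem lintegral_condProd_le_one {α γ : Type} [Countable α] [MeasurableSpace α]
    [MeasurableSingletonClass α]
    {F : Ω → α} {G : Ω → β} (hF : Measurable F) (hG : Measurable G) (φ : α → γ) (ψ : β → γ)
    (hφψ : ∀ ω, φ (F ω) = ψ (G ω)) :
    ∫⁻ ω, P (F ⁻¹' {F ω}) * P (G ⁻¹' {G ω}) *
      (P ((fun ω => (F ω, G ω)) ⁻¹' {(F ω, G ω)}) *
        P ((fun ω => φ (F ω)) ⁻¹' {φ (F ω)}))⁻¹ ∂P ≤ 1 := by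
  classical
  have hE : Measurable fun ω => (F ω, G ω) := hF.prodMk hG
  set f : α × β → ENNReal := fun e => P (F ⁻¹' {e.1}) * P (G ⁻¹' {e.2}) *
      (P ((fun ω => (F ω, G ω)) ⁻¹' {e}) * P ((fun ω => φ (F ω)) ⁻¹' {φ e.1}))⁻¹ with hf
  -- Summing the law of `G` over the letters compatible with `x` gives the probability of the common
  -- value `φ x`.
  have key : ∀ x : α, ∑' y : β, (if ψ y = φ x then P (G ⁻¹' {y}) else 0)
      = P ((fun ω => φ (F ω)) ⁻¹' {φ x}) := by
    intro x
    have h := lintegral_comp_eq_tsum (P := P) hG (fun y => if ψ y = φ x then 1 else 0)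
    simp only [ite_mul, one_mul, zero_mul] at h
    rw [← h]
    have hm : MeasurableSet ((fun ω => φ (F ω)) ⁻¹' {φ x}) :=
      hF (φ ⁻¹' {φ x}).to_countable.measurableSet
    rw [← lintegral_indicator_one hm]
    refine lintegral_congr fun ω => ?_
    simp only [Set.indicator, Set.mem_preimage, Set.mem_singleton_iff, hφψ, Pi.one_apply]
  calc _ = ∫⁻ ω, f (F ω, G ω) ∂P := rfl
    _ = ∑' e : α × β, f e * P ((fun ω => (F ω, G ω)) ⁻¹' {e}) := lintegral_comp_eq_tsum hE f
    _ ≤ ∑' e : α × β, P (F ⁻¹' {e.1}) * ((if ψ e.2 = φ e.1 then P (G ⁻¹' {e.2}) else 0) *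
          (P ((fun ω => φ (F ω)) ⁻¹' {φ e.1}))⁻¹) := by
        refine ENNReal.tsum_le_tsum fun e => ?_
        by_cases h0 : P ((fun ω => (F ω, G ω)) ⁻¹' {e}) = 0
        · simp [h0]
        -- A pair of positive joint probability is attained, so its two letters agree on the common
        -- function.
        have hne : ((fun ω => (F ω, G ω)) ⁻¹' {e}).Nonempty := by
          by_contra h
          rw [Set.not_nonempty_iff_eq_empty] at h
          simp [h] at h0
        obtain ⟨ω, hω⟩ := hne
        have he : ψ e.2 = φ e.1 := by
          rw [← (hω : (F ω, G ω) = e)]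
          exact (hφψ ω).symm
        rw [if_pos he, hf]
        dsimp only
        rw [ENNReal.mul_inv (Or.inl h0) (Or.inl (measure_ne_top _ _))]
        have : ∀ a b c d : ENNReal, d ≠ 0 → d ≠ ⊤ → a * b * (d⁻¹ * c) * d = a * (b * c) := by
          intro a b c d hd hd'
          calc a * b * (d⁻¹ * c) * d = a * (b * c) * (d⁻¹ * d) := by ring
            _ = _ := by rw [ENNReal.inv_mul_cancel hd hd', mul_one]
        rw [this _ _ _ _ h0 (measure_ne_top _ _)]
    _ = ∑' x : α, P (F ⁻¹' {x}) * (P ((fun ω => φ (F ω)) ⁻¹' {φ x}) *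
          (P ((fun ω => φ (F ω)) ⁻¹' {φ x}))⁻¹) := by
        rw [ENNReal.tsum_prod']
        refine tsum_congr fun x => ?_
        dsimp only
        rw [ENNReal.tsum_mul_left, ENNReal.tsum_mul_right, key]
    _ ≤ ∑' x : α, P (F ⁻¹' {x}) :=
        ENNReal.tsum_le_tsum fun x => mul_le_of_le_one_right' (ENNReal.mul_inv_le_one _)
    _ = 1 := by
        have h := lintegral_comp_eq_tsum (P := P) hF (fun _ => 1)
        simpa using h.symm

end

/-! ### Shannon inequalities -/

theorem measurable_subfamily {n : ℕ} {Ω : Type} [MeasurableSpace Ω] {α : Fin n → Type}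
    [∀ i, MeasurableSpace (α i)] {X : ∀ i, Ω → α i} (hX : ∀ i, Measurable (X i))
    (A : Finset (Fin n)) : Measurable (subfamily X A) :=
  measurable_pi_lambda _ fun i => hX i

theorem mem_subfamily_fiber {n : ℕ} {Ω : Type} {α : Fin n → Type} {X : ∀ i, Ω → α i}
    {A : Finset (Fin n)} {ω ω' : Ω} :
    ω' ∈ subfamily X A ⁻¹' {subfamily X A ω} ↔ ∀ i ∈ A, X i ω' = X i ω := by
  simp [subfamily, funext_iff]

/-- Information content depends only on the partition into fibers, so X_{A ∪ B} can be traded for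
the pair (X_A, X_B). -/
theorem info_congr {b : ℝ} {Ω : Type} [MeasurableSpace Ω] {P : Measure Ω} {β γ : Type} {Y : Ω → β}
    {Z : Ω → γ} (h : ∀ ω ω', Y ω' = Y ω ↔ Z ω' = Z ω) : info b P Y = info b P Z := by
  funext ω
  have : Y ⁻¹' {Y ω} = Z ⁻¹' {Z ω} := by
    ext ω'
    simp [h]
  simp [info, this]

section
variable {b : ℝ} {Ω : Type} [MeasurableSpace Ω] {P : Measure Ω} [IsProbabilityMeasure P]

/-- The fibers of `Y` refine those of `Z`, so the inequality already holds pointwise off a null set.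
-/
theorem integral_info_le_of_determines {β γ : Type} [Countable β] [MeasurableSpace β]
    [MeasurableSingletonClass β] {Y : Ω → β} {Z : Ω → γ} (hb : 1 < b) (hY : Measurable Y)
    (h : ∀ ω ω', Y ω' = Y ω → Z ω' = Z ω) (hIY : Integrable (info b P Y) P)
    (hIZ : Integrable (info b P Z) P) : ∫ ω, info b P Z ω ∂P ≤ ∫ ω, info b P Y ω ∂P := by
  refine integral_mono_ae hIZ hIY ?_
  filter_upwards [ae_measure_fiber_ne_zero (P := P) hY] with ω hω
  have hpos : 0 < P.real (Y ⁻¹' {Y ω}) := ENNReal.toReal_pos hω (measure_ne_top _ _)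
  exact neg_le_neg (Real.logb_le_logb_of_le hb hpos (measureReal_mono fun ω' hω' => h ω ω' hω'))

/-- Let R be the ratio P(F)P(G) / (P(F,G)P(K)) at the observed values, with K the common function.
The difference of the two sides is the mean of -log_b R, which is bounded below through log R ≤ R -
1 and E R ≤ 1. -/
theorem integral_info_submodular {α β γ : Type} [Countable α] [MeasurableSpace α]
    [MeasurableSingletonClass α] [Countable β] [MeasurableSpace β]
    [MeasurableSingletonClass β] {F : Ω → α} {G : Ω → β} (hb : 1 < b) (hF : Measurable F)
    (hG : Measurable G) (φ : α → γ) (ψ : β → γ) (hφψ : ∀ ω, φ (F ω) = ψ (G ω))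
    (hIF : Integrable (info b P F) P) (hIG : Integrable (info b P G) P)
    (hIK : Integrable (info b P fun ω => φ (F ω)) P)
    (hIE : Integrable (info b P fun ω => (F ω, G ω)) P) :
    ∫ ω, info b P (fun ω => φ (F ω)) ω ∂P + ∫ ω, info b P (fun ω => (F ω, G ω)) ω ∂P
      ≤ ∫ ω, info b P F ω ∂P + ∫ ω, info b P G ω ∂P := by
  have hle := lintegral_condProd_le_one (P := P) hF hG φ ψ hφψ
  set R : Ω → ENNReal := fun ω => P (F ⁻¹' {F ω}) * P (G ⁻¹' {G ω}) *
      (P ((fun ω => (F ω, G ω)) ⁻¹' {(F ω, G ω)}) *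
        P ((fun ω => φ (F ω)) ⁻¹' {φ (F ω)}))⁻¹ with hR
  have hRm : Measurable R :=
    (measurable_of_countable fun e : α × β => P (F ⁻¹' {e.1}) * P (G ⁻¹' {e.2}) *
      (P ((fun ω => (F ω, G ω)) ⁻¹' {e}) * P ((fun ω => φ (F ω)) ⁻¹' {φ e.1}))⁻¹).comp
        (hF.prodMk hG)
  have hne : ∫⁻ ω, R ω ∂P ≠ ⊤ := ne_top_of_le_ne_top ENNReal.one_ne_top hle
  have hRi : Integrable (fun ω => (R ω).toReal) P :=
    integrable_toReal_of_lintegral_ne_top hRm.aemeasurable hne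
  have hR1 : ∫ ω, (R ω).toReal ∂P ≤ 1 := by
    rw [integral_toReal hRm.aemeasurable (ae_lt_top hRm hne)]
    exact ENNReal.toReal_le_of_le_ofReal zero_le_one (by simpa using hle)
  have hlog : 0 < Real.log b := Real.log_pos hb
  have hmain : ∫ ω, (1 - (R ω).toReal) / Real.log b ∂P ≤
      ∫ ω, ((info b P F ω + info b P G ω) - (info b P (fun ω => φ (F ω)) ω
        + info b P (fun ω => (F ω, G ω)) ω)) ∂P := by
    refine integral_mono_ae (((integrable_const 1).sub hRi).div_const _)
      ((hIF.add hIG).sub (hIK.add hIE)) ?_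
    -- The joint fiber is the smallest of the four, so its positivity gives that of the others.
    filter_upwards [ae_measure_fiber_ne_zero (P := P) (hF.prodMk hG)] with ω hω
    have pE : 0 < P.real ((fun ω => (F ω, G ω)) ⁻¹' {(F ω, G ω)}) :=
      ENNReal.toReal_pos hω (measure_ne_top _ _)
    have pF : 0 < P.real (F ⁻¹' {F ω}) :=
      pE.trans_le (measureReal_mono fun ω' h => congrArg Prod.fst h)
    have pG : 0 < P.real (G ⁻¹' {G ω}) :=
      pE.trans_le (measureReal_mono fun ω' h => congrArg Prod.snd h)
    have pK : 0 < P.real ((fun ω => φ (F ω)) ⁻¹' {φ (F ω)}) :=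
      pF.trans_le (measureReal_mono fun ω' h => congrArg φ h)
    have hRr : (R ω).toReal = P.real (F ⁻¹' {F ω}) * P.real (G ⁻¹' {G ω}) *
        (P.real ((fun ω => (F ω, G ω)) ⁻¹' {(F ω, G ω)}) *
          P.real ((fun ω => φ (F ω)) ⁻¹' {φ (F ω)}))⁻¹ := by
      simp only [hR, ENNReal.toReal_mul, ENNReal.toReal_inv, measureReal_def]
    have hRp : 0 < (R ω).toReal := by rw [hRr]; positivity
    have h1 := Real.log_le_sub_one_of_pos hRp
    have h2 : Real.log (R ω).toReal = Real.log (P.real (F ⁻¹' {F ω}))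
        + Real.log (P.real (G ⁻¹' {G ω}))
        - (Real.log (P.real ((fun ω => (F ω, G ω)) ⁻¹' {(F ω, G ω)}))
          + Real.log (P.real ((fun ω => φ (F ω)) ⁻¹' {φ (F ω)}))) := by
      rw [hRr, Real.log_mul (by positivity) (by positivity), Real.log_inv,
        Real.log_mul pF.ne' pG.ne', Real.log_mul pE.ne' pK.ne']
      ring
    have h3 : (info b P F ω + info b P G ω) - (info b P (fun ω => φ (F ω)) ω
        + info b P (fun ω => (F ω, G ω)) ω) = -Real.log (R ω).toReal / Real.log b := by
      rw [h2]
      simp only [info, Real.logb]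
      ring
    rw [h3]
    gcongr
    linarith
  have h0 : 0 ≤ ∫ ω, (1 - (R ω).toReal) / Real.log b ∂P := by
    rw [integral_div, integral_sub (integrable_const 1) hRi]
    refine div_nonneg ?_ hlog.le
    simpa using hR1
  have hsub := integral_sub (hIF.add hIG) (hIK.add hIE)
  simp only [Pi.add_apply] at hsub
  rw [hsub, integral_add hIF hIG, integral_add hIK hIE] at hmain
  linarith
end

/-- Entropy functions are polymatroids. -/
theorem entropyRegion_subset_polymatroidRegion {b : ℝ} (hb : 1 < b) (n : ℕ) :
    entropyRegion b n ⊆ polymatroidRegion n := by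
  rintro h ⟨Ω, _, P, _, α, _, _, _, X, hX, hH⟩
  have hm := measurable_subfamily hX
  have hI := fun A => (hasEntropy_iff_integral_info hb (hm A) (h A)).1 (hH A)
  refine ⟨?_, fun A B hAB => ?_, fun A B => ?_⟩
  · rw [← (hI ∅).2]
    have : ∀ ω, subfamily X ∅ ⁻¹' {subfamily X ∅ ω} = Set.univ := fun ω => by
      ext ω'
      rw [mem_subfamily_fiber]
      simp
    simp [info, this]
  · rw [← (hI A).2, ← (hI B).2]
    refine integral_info_le_of_determines hb (hm B) (fun ω ω' hω => ?_) (hI B).1 (hI A).1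
    have h1 := mem_subfamily_fiber.1 (show ω' ∈ subfamily X B ⁻¹' {subfamily X B ω} from hω)
    exact mem_subfamily_fiber.2 fun i hi => h1 i (hAB hi)
  · let φ : (∀ i : A, α i) → ∀ i : (A ∩ B : Finset (Fin n)), α i :=
      fun f i => f ⟨i, (Finset.mem_inter.1 i.2).1⟩
    let ψ : (∀ i : B, α i) → ∀ i : (A ∩ B : Finset (Fin n)), α i :=
      fun f i => f ⟨i, (Finset.mem_inter.1 i.2).2⟩
    have hφ : subfamily X (A ∩ B) = fun ω => φ (subfamily X A ω) := rfl
    have hU : info b P (subfamily X (A ∪ B))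
        = info b P fun ω => (subfamily X A ω, subfamily X B ω) := by
      refine info_congr fun ω ω' => ?_
      simp only [Prod.mk.injEq, funext_iff, subfamily, Subtype.forall, Finset.mem_union]
      exact ⟨fun h => ⟨fun i hi => h i (Or.inl hi), fun i hi => h i (Or.inr hi)⟩,
        fun h i hi => hi.elim (h.1 i) (h.2 i)⟩
    have hIE := (hI (A ∪ B)).1
    have hIK := (hI (A ∩ B)).1
    rw [hU] at hIE
    rw [hφ] at hIK
    have := integral_info_submodular hb (hm A) (hm B) φ ψ (fun _ => rfl) (hI A).1 (hI B).1 hIK hIE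
    rw [← hU, ← hφ, (hI _).2, (hI _).2, (hI _).2, (hI _).2] at this
    exact this

/-! ### Closedness and sums -/

theorem isClosed_polymatroidRegion (n : ℕ) : IsClosed (polymatroidRegion n) := by
  simp only [polymatroidRegion, Set.ofPred_and, Set.ofPred_forall]
  refine (isClosed_eq (by fun_prop) (by fun_prop)).inter (IsClosed.inter ?_ ?_)
  · exact isClosed_iInter fun A => isClosed_iInter fun B => isClosed_iInter fun _ =>
      isClosed_le (by fun_prop) (by fun_prop)
  · exact isClosed_iInter fun A => isClosed_iInter fun B =>
      isClosed_le (by fun_prop) (by fun_prop)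

theorem isClosed_symSubspace {n : ℕ} (p : Finpartition (Finset.univ : Finset (Fin n))) :
    IsClosed (symSubspace p : Set (EntropySpace n)) :=
  (symSubspace p).closed_of_finiteDimensional

/-- Sums of entropy functions are entropy functions. -/
theorem add_mem_entropyRegion {b : ℝ} (hb : 1 < b) {n : ℕ} {h₁ h₂ : EntropySpace n}
    (H₁ : h₁ ∈ entropyRegion b n) (H₂ : h₂ ∈ entropyRegion b n) : h₁ + h₂ ∈ entropyRegion b n := by
  obtain ⟨Ω₁, _, P₁, _, α₁, _, _, _, X₁, hX₁, hH₁⟩ := H₁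
  obtain ⟨Ω₂, _, P₂, _, α₂, _, _, _, X₂, hX₂, hH₂⟩ := H₂
  have hX : ∀ i, Measurable fun ω : Ω₁ × Ω₂ => (X₁ i ω.1, X₂ i ω.2) := fun i =>
    ((hX₁ i).comp measurable_fst).prodMk ((hX₂ i).comp measurable_snd)
  refine ⟨Ω₁ × Ω₂, inferInstance, P₁.prod P₂, inferInstance, fun i => α₁ i × α₂ i,
    fun i => inferInstance, fun i => inferInstance, fun i => inferInstance,
    fun i ω => (X₁ i ω.1, X₂ i ω.2), hX, fun A => ?_⟩
  have m₁ := measurable_subfamily hX₁ A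
  have m₂ := measurable_subfamily hX₂ A
  have hm := measurable_subfamily hX A
  obtain ⟨i₁, e₁⟩ := (hasEntropy_iff_integral_info hb m₁ _).1 (hH₁ A)
  obtain ⟨i₂, e₂⟩ := (hasEntropy_iff_integral_info hb m₂ _).1 (hH₂ A)
  rw [hasEntropy_iff_integral_info hb hm]
  -- Fibers of the paired family are rectangles. The product rule for the logarithm needs nonzero
  -- factors, hence equality only almost everywhere.
  have hae : info b (P₁.prod P₂) (subfamily (fun i (ω : Ω₁ × Ω₂) => (X₁ i ω.1, X₂ i ω.2)) A)
      =ᵐ[P₁.prod P₂] fun ω => info b P₁ (subfamily X₁ A) ω.1 + info b P₂ (subfamily X₂ A) ω.2 := by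
    filter_upwards [ae_measure_fiber_ne_zero (P := P₁.prod P₂) hm] with ω hω
    have hs : subfamily (fun i (ω : Ω₁ × Ω₂) => (X₁ i ω.1, X₂ i ω.2)) A ⁻¹'
        {subfamily (fun i (ω : Ω₁ × Ω₂) => (X₁ i ω.1, X₂ i ω.2)) A ω} =
        (subfamily X₁ A ⁻¹' {subfamily X₁ A ω.1}) ×ˢ (subfamily X₂ A ⁻¹' {subfamily X₂ A ω.2}) := by
      ext ω'
      rw [mem_subfamily_fiber, Set.mem_prod, mem_subfamily_fiber, mem_subfamily_fiber]
      simp only [Prod.mk.injEq, forall_and]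
    rw [hs, Measure.prod_prod, mul_ne_zero_iff] at hω
    have p₁ : P₁.real (subfamily X₁ A ⁻¹' {subfamily X₁ A ω.1}) ≠ 0 :=
      (ENNReal.toReal_pos hω.1 (measure_ne_top _ _)).ne'
    have p₂ : P₂.real (subfamily X₂ A ⁻¹' {subfamily X₂ A ω.2}) ≠ 0 :=
      (ENNReal.toReal_pos hω.2 (measure_ne_top _ _)).ne'
    simp only [info]
    rw [hs, measureReal_prod_prod, Real.logb_mul p₁ p₂, neg_add]
  have j₁ := i₁.comp_fst P₂
  have j₂ := i₂.comp_snd P₁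
  refine ⟨(j₁.add j₂).congr hae.symm, ?_⟩
  rw [integral_congr_ae hae, integral_add j₁ j₂, integral_fun_fst, integral_fun_snd, e₁, e₂]
  simp

/-! ### Switched uniform codes and their limits -/

/-- The entropy function of random variables on a finite probability space. -/
theorem mem_entropyRegion_of_fintype {b : ℝ} (hb : 1 < b) {n : ℕ} {V : Type} [Fintype V]
    (p : V → ℝ) (hp0 : ∀ v, 0 ≤ p v) (hp1 : ∑ v, p v = 1) {α : Fin n → Type} [∀ i, Finite (α i)]
    (X : ∀ i, V → α i) :
    (fun A : Finset (Fin n) => ∑ v, p v *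
      -Real.logb b (∑ w, Set.indicator {w | ∀ i ∈ A, X i w = X i v} p w)) ∈
      entropyRegion b n := by
  let _ : MeasurableSpace V := ⊤
  let _ : ∀ i, MeasurableSpace (α i) := fun _ => ⊤
  have hsum : ∑ v, ENNReal.ofReal (p v) = 1 := by
    rw [← ENNReal.ofReal_sum_of_nonneg fun v _ => hp0 v, hp1, ENNReal.ofReal_one]
  let μ : PMF V := PMF.ofFintype (fun v => ENNReal.ofReal (p v)) hsum
  have hreal : ∀ s : Set V, μ.toMeasure.real s = ∑ w, s.indicator p w := by
    intro s
    rw [measureReal_def, PMF.toMeasure_apply_fintype, ENNReal.toReal_sum]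
    · refine Finset.sum_congr rfl fun w _ => ?_
      by_cases hw : w ∈ s <;> simp [hw, μ, ENNReal.toReal_ofReal (hp0 w)]
    · intro w _
      by_cases hw : w ∈ s <;> simp [hw, μ]
  have hX : ∀ i, Measurable (X i) := fun i => measurable_from_top
  refine ⟨V, inferInstance, μ.toMeasure, inferInstance, α, fun i => inferInstance,
    fun i => inferInstance, fun i => ⟨fun _ => trivial⟩, X, hX, fun A => ?_⟩
  have : ∀ i, MeasurableSingletonClass (α i) := fun i => ⟨fun _ => trivial⟩
  have : MeasurableSingletonClass V := ⟨fun _ => trivial⟩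
  rw [hasEntropy_iff_integral_info hb (measurable_subfamily hX A)]
  refine ⟨.of_finite, ?_⟩
  rw [PMF.integral_eq_sum]
  refine Finset.sum_congr rfl fun v _ => ?_
  have h1 : (μ v).toReal = p v := ENNReal.toReal_ofReal (hp0 v)
  have h2 : subfamily X A ⁻¹' {subfamily X A v} = {w | ∀ i ∈ A, X i w = X i v} :=
    Set.ext fun _ => mem_subfamily_fiber
  simp only [info, h1, smul_eq_mul, hreal, h2]

/-- There are random variables, uniform on a finite set, such that every subfamily `X_A` is uniform
on a set of `q ^ ρ A` values. -/
def HasUniformCode {n : ℕ} (q : ℕ) (ρ : Finset (Fin n) → ℕ) : Prop :=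
  ∃ (V : Type) (_ : Finite V) (_ : Nonempty V) (α : Fin n → Type) (_ : ∀ i, Finite (α i))
    (X : ∀ i, V → α i), ∀ (A : Finset (Fin n)) (v : V),
      Nat.card {w // ∀ i ∈ A, X i w = X i v} * q ^ ρ A = Nat.card V

/-- A uniform code that is switched on with probability `δ`. -/
theorem HasUniformCode.switched_mem_entropyRegion {b : ℝ} (hb : 1 < b) {n q : ℕ} (hq : 0 < q)
    {ρ : Finset (Fin n) → ℕ} (h : HasUniformCode q ρ) {δ : ℝ} (h0 : 0 ≤ δ) (h1 : δ ≤ 1) :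
    (fun A => if A = ∅ then 0 else Real.binEntropy δ / Real.log b + δ * Real.logb b q * ρ A) ∈
      entropyRegion b n := by
  classical
  obtain ⟨V, _, _, α, _, X, hX⟩ := h
  have := Fintype.ofFinite V
  have hc : (0 : ℝ) < Fintype.card V := Nat.cast_pos.2 Fintype.card_pos
  -- The outcome `none` is the off state. Every coordinate sends it to its own `none`, so any single
  -- coordinate reveals the switch.
  have hmem := mem_entropyRegion_of_fintype hb
    (fun o : Option V => o.elim (1 - δ) fun _ => δ / Fintype.card V)
    (by rintro (_ | v)
        · simpa using h1
        · exact div_nonneg h0 hc.le)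
    (by simp [Fintype.sum_option, mul_div_cancel₀ _ hc.ne'])
    (fun i => Option.map (X i))
  convert hmem using 1
  funext A
  by_cases hA : A = ∅
  · simp [hA, Fintype.sum_option, mul_div_cancel₀ _ hc.ne']
  obtain ⟨j, hj⟩ := Finset.nonempty_iff_ne_empty.2 hA
  rw [if_neg hA, Fintype.sum_option]
  have f0 : ∑ w, Set.indicator {w | ∀ i ∈ A, Option.map (X i) w = Option.map (X i) none}
      (fun o : Option V => o.elim (1 - δ) fun _ => δ / Fintype.card V) w = 1 - δ := by
    have : ∀ v : V, ¬ ∀ i ∈ A, Option.map (X i) (some v) = Option.map (X i) none := fun v hv => by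
      simpa using hv j hj
    rw [Fintype.sum_option, Set.indicator_of_mem (by simp), Finset.sum_eq_zero, add_zero]
    · rfl
    · exact fun v _ => Set.indicator_of_notMem (by exact this v) _
  have f1 : ∀ v, ∑ w, Set.indicator {w | ∀ i ∈ A, Option.map (X i) w = Option.map (X i) (some v)}
      (fun o : Option V => o.elim (1 - δ) fun _ => δ / Fintype.card V) w = δ / (q : ℝ) ^ ρ A := by
    intro v
    have hn : none ∉ {w | ∀ i ∈ A, Option.map (X i) w = Option.map (X i) (some v)} := fun hv => by
      simpa using hv j hj
    rw [Fintype.sum_option, Set.indicator_of_notMem hn, zero_add]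
    simp only [Set.indicator_apply, Set.mem_ofPred_eq]
    rw [← Finset.sum_filter]
    have hcard := hX A v
    rw [Nat.card_eq_fintype_card, Nat.card_eq_fintype_card, Fintype.card_subtype] at hcard
    have hcard' : ((Finset.univ.filter fun w => ∀ i ∈ A, X i w = X i v).card : ℝ) * (q : ℝ) ^ ρ A = Fintype.card V := by
      exact_mod_cast hcard
    have hq' : (0 : ℝ) < (q : ℝ) ^ ρ A := by positivity
    simp only [Option.map_some, Option.some.injEq, Option.elim_some, Finset.sum_const,
      nsmul_eq_mul]
    rw [eq_div_iff hq'.ne']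
    field_simp
    linear_combination δ * hcard'
  simp only [f0, f1, Option.elim_none, Option.elim_some, Finset.sum_const, Finset.card_univ,
    nsmul_eq_mul]
  -- The logarithm of δ / q ^ ρ A splits only for δ ≠ 0.
  rcases h0.eq_or_lt with rfl | hδ
  · simp
  have hq' : (0 : ℝ) < q := by exact_mod_cast hq
  rw [Real.logb_div hδ.ne' (by positivity), Real.logb_pow, Real.binEntropy]
  simp only [Real.logb, Real.log_inv]
  field_simp
  ring

/-- The switch contributes the same amount to every nonempty set. The blocks cover the index set, so
the block counts detect emptiness. -/
theorem mem_symSubspace_nonempty {n : ℕ} (p : Finpartition (Finset.univ : Finset (Fin n))) (c : ℝ) :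
    (fun A => if A = ∅ then 0 else c) ∈ symSubspace p := by
  intro A B hAB
  have key : ∀ A B : Finset (Fin n), (∀ N ∈ p.parts, (A ∩ N).card = (B ∩ N).card) →
      A = ∅ → B = ∅ := by
    rintro A B h rfl
    refine Finset.eq_empty_of_forall_notMem fun i hi => ?_
    obtain ⟨N, hN, hiN⟩ := p.exists_mem (Finset.mem_univ i)
    have := h N hN
    rw [Finset.empty_inter, Finset.card_empty, eq_comm, Finset.card_eq_zero] at this
    exact Finset.notMem_empty i (this ▸ Finset.mem_inter.2 ⟨hi, hiN⟩)
  have : A = ∅ ↔ B = ∅ := ⟨key A B hAB, key B A fun N hN => (hAB N hN).symm⟩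
  simp [this]

open Filter Topology in
/-- Nonnegative multiples of rank functions with uniform codes over arbitrarily large alphabets are
limits of entropy functions with the same symmetry. -/
theorem smul_mem_closure_symEntropyRegion {b : ℝ} (hb : 1 < b) {n : ℕ}
    {p : Finpartition (Finset.univ : Finset (Fin n))} {ρ : Finset (Fin n) → ℕ} (hρ0 : ρ ∅ = 0)
    (hρ : (fun A => (ρ A : ℝ)) ∈ symSubspace p) (hcode : ∃ᶠ q in atTop, HasUniformCode q ρ)
    {c : ℝ} (hc : 0 ≤ c) :
    (fun A => c * (ρ A : ℝ)) ∈ closure (symEntropyRegion b p) := by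
  -- This choice keeps the code's contribution δ · log_b q · ρ A equal to c · ρ A while the switch
  -- entropy vanishes in the limit.
  let δ : ℕ → ℝ := fun q => c / Real.logb b q
  let u : ℕ → EntropySpace n := fun q A =>
    if A = ∅ then 0 else Real.binEntropy (δ q) / Real.log b + δ q * Real.logb b q * ρ A
  have hlog : Tendsto (fun q : ℕ => Real.logb b q) atTop atTop :=
    (Real.tendsto_logb_atTop hb).comp tendsto_natCast_atTop_atTop
  have hδ : Tendsto δ atTop (𝓝 0) := hlog.const_div_atTop c
  have hu : Tendsto u atTop (𝓝 fun A => c * (ρ A : ℝ)) := by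
    rw [tendsto_pi_nhds]
    intro A
    by_cases hA : A = ∅
    · simp [u, hA, hρ0]
    have hE : Tendsto (fun q => Real.binEntropy (δ q) / Real.log b) atTop (𝓝 0) := by
      have := ((Real.binEntropy_continuous.tendsto 0).comp hδ).div_const (Real.log b)
      simpa using this
    have hM : Tendsto (fun q => Real.binEntropy (δ q) / Real.log b + c * ρ A) atTop
        (𝓝 (c * ρ A)) := by
      simpa using hE.add_const (c * (ρ A : ℝ))
    refine hM.congr' ?_
    filter_upwards [hlog.eventually_gt_atTop 0] with q hq
    simp only [u, if_neg hA, δ, div_mul_cancel₀ _ hq.ne']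
  rw [mem_closure_iff_frequently]
  refine hu.frequently ((hcode.and_eventually ((eventually_gt_atTop 0).and
    ((hlog.eventually_gt_atTop 0).and (hδ.eventually_le_const zero_lt_one)))).mono ?_)
  rintro q ⟨hq, hq0, hl, h1⟩
  refine ⟨hq.switched_mem_entropyRegion hb hq0 (div_nonneg hc hl.le) h1, ?_⟩
  have hsplit : u q = (fun A => if A = ∅ then 0 else Real.binEntropy (δ q) / Real.log b)
      + (δ q * Real.logb b q) • fun A => (ρ A : ℝ) := by
    funext A
    by_cases hA : A = ∅ <;> simp [u, hA, hρ0]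
  show u q ∈ symSubspace p
  rw [hsplit]
  exact add_mem (mem_symSubspace_nonempty p _) ((symSubspace p).smul_mem _ hρ)

/-! ### Reed-Solomon codes -/

open Polynomial in
/-- The number of polynomials of degree less than `k` with prescribed values on `T`. -/
theorem card_degreeLT_eval_eq {F : Type} [Field F] [Finite F] (k : ℕ) (v : ℕ → F) (T : Finset ℕ)
    (hv : Set.InjOn v T) (f : degreeLT F k) :
    Nat.card {g : degreeLT F k // ∀ t ∈ T, (g : F[X]).eval (v t) = (f : F[X]).eval (v t)} *
      Nat.card F ^ min T.card k = Nat.card F ^ k := by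
  have hcardV : Nat.card (degreeLT F k) = Nat.card F ^ k := by
    rw [Nat.card_congr (degreeLTEquiv F k).toEquiv, Nat.card_fun, Nat.card_fin]
  rcases le_total k T.card with hk | hk
  · rw [min_eq_right hk]
    -- With at least k nodes the values determine the polynomial.
    have : Nat.card {g : degreeLT F k //
        ∀ t ∈ T, (g : F[X]).eval (v t) = (f : F[X]).eval (v t)} = 1 := by
      rw [Nat.card_eq_one_iff_unique]
      refine ⟨⟨fun g g' => ?_⟩, ⟨⟨f, fun _ _ => rfl⟩⟩⟩
      refine Subtype.ext (Subtype.ext ?_)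
      have hlt : ∀ g : degreeLT F k, (g : F[X]).degree < T.card := fun g =>
        (mem_degreeLT.1 g.2).trans_le (by exact_mod_cast hk)
      exact eq_of_degrees_lt_of_eval_index_eq T hv (hlt _) (hlt _)
        fun t ht => (g.2 t ht).trans (g'.2 t ht).symm
    rw [this, one_mul]
  · rw [min_eq_left hk]
    -- With at most k nodes, evaluation is onto by Lagrange interpolation. The set to be counted is
    -- a translate by `f` of its kernel.
    let φ : degreeLT F k →ₗ[F] (T → F) :=
      LinearMap.pi fun t => (Polynomial.leval (v t)).comp (degreeLT F k).subtype
    have hφ : Function.Surjective φ := by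
      classical
      intro y
      let r : ℕ → F := fun t => if h : t ∈ T then y ⟨t, h⟩ else 0
      refine ⟨⟨Lagrange.interpolate T v r, mem_degreeLT.2 <|
        (Lagrange.degree_interpolate_lt r hv).trans_le (by exact_mod_cast hk)⟩, ?_⟩
      funext t
      have := Lagrange.eval_interpolate_at_node r hv t.2
      simp only [φ, LinearMap.pi_apply, LinearMap.comp_apply, Submodule.subtype_apply,
        Polynomial.leval_apply, this]
      simp [r]
    have hker : Nat.card {g : degreeLT F k //
        ∀ t ∈ T, (g : F[X]).eval (v t) = (f : F[X]).eval (v t)} = Nat.card (LinearMap.ker φ) := by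
      refine Nat.card_congr ((Equiv.subRight f).subtypeEquiv fun g => ?_)
      rw [LinearMap.mem_ker]
      simp [φ, funext_iff, sub_eq_zero]
    have hq := Submodule.card_eq_card_quotient_mul_card (LinearMap.ker φ)
    rw [Nat.card_congr (φ.quotKerEquivOfSurjective hφ).toEquiv, hcardV] at hq
    rw [hker, hq, Nat.card_fun, Nat.card_eq_finsetCard]

/-- The points at which the `i`-th coordinate of the code evaluates a polynomial. -/
def codePoints (n r : ℕ) (z i : Fin n) : Finset ℕ :=
  if i = z then Finset.Ico n (n + r) else {i.val}

theorem card_biUnion_codePoints {n : ℕ} (r : ℕ) (z : Fin n) (A : Finset (Fin n)) :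
    (A.biUnion (codePoints n r z)).card = (A.erase z).card + if z ∈ A then r else 0 := by
  have h1 : ((A.erase z).biUnion (codePoints n r z)) = (A.erase z).map Fin.valEmbedding := by
    ext t
    simp only [Finset.mem_biUnion, Finset.mem_map]
    refine exists_congr fun i => and_congr_right fun hi => ?_
    simp [codePoints, Finset.ne_of_mem_erase hi, eq_comm]
  have h2 : codePoints n r z z = Finset.Ico n (n + r) := by simp [codePoints]
  by_cases hz : z ∈ A
  · rw [if_pos hz, ← Finset.insert_erase hz, Finset.biUnion_insert, Finset.insert_erase hz, h1, h2,
      Finset.card_union_of_disjoint, Finset.card_map, Nat.card_Ico]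
    · omega
    · rw [Finset.disjoint_left]
      intro t ht ht'
      obtain ⟨i, -, rfl⟩ := Finset.mem_map.1 ht'
      exact absurd (Finset.mem_Ico.1 ht).1 (not_le.2 i.2)
  · rw [if_neg hz, add_zero]
    conv_lhs => rw [← Finset.erase_eq_of_notMem hz]
    rw [h1, Finset.card_map]

open Polynomial in
/-- Reed-Solomon codes, one coordinate of which is a block of `r` evaluations. -/
theorem hasUniformCode_min {n q : ℕ} (k r : ℕ) (z : Fin n) (hq : q.Prime) (hn : n + r ≤ q) :
    HasUniformCode q fun A : Finset (Fin n) =>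
      min ((A.erase z).card + if z ∈ A then r else 0) k := by
  have : Fact q.Prime := ⟨hq⟩
  have hfin : Finite (degreeLT (ZMod q) k) :=
    Finite.of_equiv _ (degreeLTEquiv (ZMod q) k).toEquiv.symm
  refine ⟨degreeLT (ZMod q) k, hfin, ⟨0⟩, fun i => codePoints n r z i → ZMod q, fun i => inferInstance,
    fun i f t => (f : (ZMod q)[X]).eval ((t : ℕ) : ZMod q), fun A f => ?_⟩
  -- All evaluation points lie below n + r ≤ q, so they stay distinct modulo q.
  have hinj : Set.InjOn (Nat.cast : ℕ → ZMod q) (A.biUnion (codePoints n r z)) := by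
    have hlt : ∀ t ∈ A.biUnion (codePoints n r z), t < q := by
      intro t ht
      obtain ⟨i, -, ht⟩ := Finset.mem_biUnion.1 ht
      unfold codePoints at ht
      split_ifs at ht
      · exact (Finset.mem_Ico.1 ht).2.trans_le hn
      · rw [Finset.mem_singleton.1 ht]
        omega
    intro s hs t ht hst
    have := (ZMod.natCast_eq_natCast_iff' s t q).1 hst
    rwa [Nat.mod_eq_of_lt (hlt s hs), Nat.mod_eq_of_lt (hlt t ht)] at this
  have key := card_degreeLT_eval_eq k (Nat.cast : ℕ → ZMod q) _ hinj f
  rw [card_biUnion_codePoints, Nat.card_zmod] at key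
  rw [Nat.card_congr (degreeLTEquiv (ZMod q) k).toEquiv]
  have hV : Nat.card (Fin k → ZMod q) = q ^ k := by rw [Nat.card_fun, Nat.card_zmod, Nat.card_fin]
  have hiff : ∀ g : degreeLT (ZMod q) k,
      (∀ i ∈ A, (fun t : codePoints n r z i => (g : (ZMod q)[X]).eval ((t : ℕ) : ZMod q))
        = fun t : codePoints n r z i => (f : (ZMod q)[X]).eval ((t : ℕ) : ZMod q)) ↔
      ∀ t ∈ A.biUnion (codePoints n r z),
        (g : (ZMod q)[X]).eval (t : ZMod q) = (f : (ZMod q)[X]).eval (t : ZMod q) := by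
    intro g
    simp only [funext_iff, Subtype.forall, Finset.mem_biUnion]
    exact ⟨fun h t ⟨i, hi, ht⟩ => h i hi t ht, fun h i hi t ht => h t ⟨i, hi, ht⟩⟩
  rw [hV, ← key, Nat.card_congr (Equiv.subtypeEquivRight hiff)]

/-- A single uniform variable. -/
theorem hasUniformCode_single {n q : ℕ} (hq : 0 < q) (z : Fin n) :
    HasUniformCode q fun A : Finset (Fin n) => if z ∈ A then 1 else 0 := by
  refine ⟨Fin q, inferInstance, ⟨⟨0, hq⟩⟩, fun _ => Fin q, fun _ => inferInstance,
    fun i v => if i = z then v else ⟨0, hq⟩, fun A v => ?_⟩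
  by_cases hz : z ∈ A
  · have : ∀ w : Fin q, (∀ i ∈ A, (if i = z then w else ⟨0, hq⟩)
        = if i = z then v else (⟨0, hq⟩ : Fin q)) ↔ w = v := by
      refine fun w => ⟨fun h => by simpa using h z hz, ?_⟩
      rintro rfl i _
      rfl
    simp [this, hz]
  · have : ∀ w : Fin q, (∀ i ∈ A, (if i = z then w else ⟨0, hq⟩)
        = if i = z then v else (⟨0, hq⟩ : Fin q)) := by
      intro w i hi
      have : i ≠ z := fun h => hz (h ▸ hi)
      simp [this]
    rw [Nat.card_congr (Equiv.subtypeUnivEquiv this)]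
    simp [hz]

/-! ### Symmetric functions in terms of increments -/

theorem mem_symSubspace_partitionOneRest_iff {n : ℕ} (hn : 2 ≤ n) (h : EntropySpace n) :
    h ∈ symSubspace (partitionOneRest n hn) ↔ ∀ A B : Finset (Fin n),
      ((⟨0, by omega⟩ : Fin n) ∈ A ↔ (⟨0, by omega⟩ : Fin n) ∈ B) →
      (A.erase ⟨0, by omega⟩).card = (B.erase ⟨0, by omega⟩).card → h A = h B := by
  have he : ∀ A : Finset (Fin n),
      A ∩ Finset.univ.erase ⟨0, by omega⟩ = A.erase ⟨0, by omega⟩ := fun A => by ext; simp [and_comm]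
  have hs : ∀ A B : Finset (Fin n), (A ∩ {⟨0, by omega⟩}).card = (B ∩ {⟨0, by omega⟩}).card ↔
      ((⟨0, by omega⟩ : Fin n) ∈ A ↔ (⟨0, by omega⟩ : Fin n) ∈ B) := by
    intro A B
    by_cases hA : (⟨0, by omega⟩ : Fin n) ∈ A <;> by_cases hB : (⟨0, by omega⟩ : Fin n) ∈ B <;>
      simp [hA, hB, Finset.inter_singleton_of_mem, Finset.inter_singleton_of_notMem]
  have hp : ∀ A B : Finset (Fin n),
      (∀ N ∈ (partitionOneRest n hn).parts, (A ∩ N).card = (B ∩ N).card) ↔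
      ((⟨0, by omega⟩ : Fin n) ∈ A ↔ (⟨0, by omega⟩ : Fin n) ∈ B) ∧
      (A.erase ⟨0, by omega⟩).card = (B.erase ⟨0, by omega⟩).card := by
    intro A B
    rw [← hs, ← he A, ← he B]
    simp [partitionOneRest]
  show (∀ A B : Finset (Fin n), _ → _) ↔ _
  simp only [hp, and_imp]

/-- The function on subsets with increments `α` along the sets that avoid `z`, increments `β` along
the sets that contain `z`, and value at the whole set exceeding that at the complement of `z` by
`t`. -/
def profile {n : ℕ} (z : Fin n) (α β : ℕ → ℝ) (t : ℝ) : EntropySpace n := fun A =>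
  -- The starting value at {z} is adjusted so that the excess at full size is exactly `t`, which
  -- makes the function additive in (α, β, t).
  if z ∈ A then t + ∑ i ∈ Finset.range (n - 1), (α i - β i)
      + ∑ i ∈ Finset.range (A.erase z).card, β i
  else ∑ i ∈ Finset.range (A.erase z).card, α i

theorem profile_add {n : ℕ} (z : Fin n) (α β α' β' : ℕ → ℝ) (t t' : ℝ) :
    profile z α β t + profile z α' β' t' = profile z (α + α') (β + β') (t + t') := by
  funext A
  by_cases h : z ∈ A
  · simp only [profile, Pi.add_apply, if_pos h, Finset.sum_add_distrib, Finset.sum_sub_distrib]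
    ring
  · simp only [profile, Pi.add_apply, if_neg h, Finset.sum_add_distrib]

theorem profile_mem_symSubspace {n : ℕ} (hn : 2 ≤ n) (α β : ℕ → ℝ) (t : ℝ) :
    profile ⟨0, by omega⟩ α β t ∈ symSubspace (partitionOneRest n hn) := by
  rw [mem_symSubspace_partitionOneRest_iff]
  intro A B h h'
  simp only [profile, h, h']

/-- The sequence equal to `c` on the first `k` indices and to zero afterwards. -/
def stepSeq (k : ℕ) (c : ℝ) : ℕ → ℝ := fun i => if i < k then c else 0

theorem sum_range_stepSeq (k : ℕ) (c : ℝ) (j : ℕ) :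
    ∑ i ∈ Finset.range j, stepSeq k c i = c * (min j k : ℕ) := by
  have : (Finset.range j).filter (· < k) = Finset.range (min j k) := by ext; simp
  simp only [stepSeq]
  rw [← Finset.sum_filter, this, Finset.sum_const, Finset.card_range, nsmul_eq_mul, mul_comm]

/-- Identifies a step pair with a Reed-Solomon rank: the variable at `z` has rank k - l, leaving
room for l further increments before the cap k. -/
theorem profile_stepSeq {n : ℕ} (z : Fin n) {k l : ℕ} (hlk : l ≤ k) (hk : k ≤ n - 1) (c : ℝ) :
    profile z (stepSeq k c) (stepSeq l c) 0 = fun A : Finset (Fin n) =>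
      c * ((min ((A.erase z).card + if z ∈ A then k - l else 0) k : ℕ) : ℝ) := by
  funext A
  by_cases h : z ∈ A
  · simp only [profile, if_pos h, Finset.sum_sub_distrib, sum_range_stepSeq]
    rw [min_eq_right hk, min_eq_right (hlk.trans hk)]
    have : min ((A.erase z).card + (k - l)) k = (k - l) + min (A.erase z).card l := by omega
    rw [this]
    push_cast [hlk]
    ring
  · simp only [profile, if_neg h, sum_range_stepSeq, add_zero]

theorem profile_single {n : ℕ} (z : Fin n) (t : ℝ) :
    profile z 0 0 t = fun A : Finset (Fin n) => t * ((if z ∈ A then 1 else 0 : ℕ) : ℝ) := by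
  funext A
  by_cases h : z ∈ A <;> simp [profile, h]

theorem add_mem_closure_symEntropyRegion {b : ℝ} (hb : 1 < b) {n : ℕ}
    {p : Finpartition (Finset.univ : Finset (Fin n))} {f g : EntropySpace n}
    (hf : f ∈ closure (symEntropyRegion b p)) (hg : g ∈ closure (symEntropyRegion b p)) :
    f + g ∈ closure (symEntropyRegion b p) :=
  map_mem_closure₂ continuous_add hf hg fun _ h _ h' =>
    ⟨add_mem_entropyRegion hb h.1 h'.1, (symSubspace p).add_mem h.2 h'.2⟩

theorem profile_stepSeq_mem_closure {b : ℝ} (hb : 1 < b) {n : ℕ} (hn : 2 ≤ n) {k l : ℕ}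
    (hlk : l ≤ k) (hk : k ≤ n - 1) {c : ℝ} (hc : 0 ≤ c) :
    profile ⟨0, by omega⟩ (stepSeq k c) (stepSeq l c) 0 ∈
      closure (symEntropyRegion b (partitionOneRest n hn)) := by
  rw [profile_stepSeq _ hlk hk]
  refine smul_mem_closure_symEntropyRegion hb (by simp) ?_ ?_ hc
  · have := profile_stepSeq (⟨0, by omega⟩ : Fin n) hlk hk 1
    simp only [one_mul] at this
    rw [← this]
    exact profile_mem_symSubspace hn _ _ _
  · have hp : ∃ᶠ q in Filter.atTop, Nat.Prime q :=
      Nat.frequently_atTop_iff_infinite.2 Nat.infinite_setOfPred_prime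
    exact (hp.and_eventually (Filter.eventually_ge_atTop (n + (k - l)))).mono
      fun q hq => hasUniformCode_min k (k - l) _ hq.1 hq.2

theorem profile_single_mem_closure {b : ℝ} (hb : 1 < b) {n : ℕ} (hn : 2 ≤ n) {t : ℝ}
    (ht : 0 ≤ t) :
    profile ⟨0, by omega⟩ 0 0 t ∈ closure (symEntropyRegion b (partitionOneRest n hn)) := by
  rw [profile_single]
  refine smul_mem_closure_symEntropyRegion hb (by simp) ?_ ?_ ht
  · have := profile_single (⟨0, by omega⟩ : Fin n) 1
    simp only [one_mul] at this
    rw [← this]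
    exact profile_mem_symSubspace hn _ _ _
  · exact ((Filter.eventually_gt_atTop 0).mono fun q hq => hasUniformCode_single hq _).frequently

/-! ### Decomposition into steps -/

/-- The bound on `c` keeps the first k entries nonnegative after subtraction, so there is no upward
jump to the zeros that follow. -/
theorem antitone_sub_stepSeq {α : ℕ → ℝ} (hα : Antitone α) {k : ℕ} (hk : ∀ i, k ≤ i → α i = 0)
    {c : ℝ} (hc : ∀ i < k, c ≤ α i) : Antitone (α - stepSeq k c) := by
  intro i j hij
  have := hα hij
  simp only [Pi.sub_apply, stepSeq]
  by_cases hi : i < k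
  · by_cases hj : j < k
    · simp only [hi, hj, if_true]
      linarith
    · simp only [hi, hj, if_true, if_false, hk j (not_lt.1 hj)]
      linarith [hc i hi]
  · have hj : ¬ j < k := fun h => hi (hij.trans_lt h)
    simp only [hi, hj, if_false]
    linarith

/-- A step of height equal to the last entry cancels that entry; this is how the induction shortens
the support. -/
theorem sub_stepSeq_eq_zero {α : ℕ → ℝ} {k : ℕ} (hk : ∀ i, k + 1 ≤ i → α i = 0) {i : ℕ}
    (hi : k ≤ i) : (α - stepSeq (k + 1) (α k)) i = 0 := by
  rcases hi.eq_or_lt with rfl | hi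
  · simp [stepSeq]
  · simp [stepSeq, hk i hi, Nat.not_lt.2 hi]

/-- Only indices l ≤ i < k need care: there β vanishes and α i is at least the subtracted c. -/
theorem sub_stepSeq_le_sub_stepSeq {α β : ℕ → ℝ} {k l : ℕ} {c : ℝ} (hβα : β ≤ α) (hlk : l ≤ k)
    (hc : ∀ i < k, c ≤ α i) (hl : ∀ i, l ≤ i → β i = 0) :
    β - stepSeq l c ≤ α - stepSeq k c := by
  intro i
  have := hβα i
  simp only [Pi.sub_apply, stepSeq]
  by_cases hi : i < l
  · simp only [hi, hi.trans_le hlk, if_true]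
    linarith
  · by_cases hi' : i < k
    · simp only [hi, hi', if_true, if_false, hl i (not_lt.1 hi)]
      linarith [hc i hi']
    · simp only [hi, hi', if_false]
      linarith

theorem profile_mem_closure_of_sub_stepSeq {b : ℝ} (hb : 1 < b) {n : ℕ} (hn : 2 ≤ n) {k l : ℕ}
    (hlk : l ≤ k) (hk : k ≤ n - 1) {α β : ℕ → ℝ} {c t : ℝ} (hc : 0 ≤ c)
    (h : profile ⟨0, by omega⟩ (α - stepSeq k c) (β - stepSeq l c) t ∈
      closure (symEntropyRegion b (partitionOneRest n hn))) :
    profile ⟨0, by omega⟩ α β t ∈ closure (symEntropyRegion b (partitionOneRest n hn)) := by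
  have := add_mem_closure_symEntropyRegion hb h (profile_stepSeq_mem_closure hb hn hlk hk hc)
  rwa [profile_add, sub_add_cancel, sub_add_cancel, add_zero] at this

/-- Pairs of nonincreasing sequences `0 ≤ β ≤ α` decompose into pairs of step sequences. -/
theorem profile_mem_closure {b : ℝ} (hb : 1 < b) {n : ℕ} (hn : 2 ≤ n) {t : ℝ} (ht : 0 ≤ t) :
    ∀ (k l : ℕ) (α β : ℕ → ℝ), l ≤ k → k ≤ n - 1 → Antitone α → Antitone β → β ≤ α →
      (∀ i, k ≤ i → α i = 0) → (∀ i, l ≤ i → β i = 0) →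
      profile ⟨0, by omega⟩ α β t ∈ closure (symEntropyRegion b (partitionOneRest n hn)) := by
  have le_head : ∀ {α : ℕ → ℝ} {m : ℕ}, Antitone α → ∀ i < m + 1, α m ≤ α i :=
    fun hα i hi => hα (Nat.lt_succ_iff.1 hi)
  intro k
  induction k with
  | zero =>
    intro l α β hl _ _ _ _ h0 h0'
    obtain rfl : l = 0 := by omega
    obtain rfl : α = 0 := funext fun i => h0 i (Nat.zero_le _)
    obtain rfl : β = 0 := funext fun i => h0' i (Nat.zero_le _)
    exact profile_single_mem_closure hb hn ht
  | succ k ihk =>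
    -- If the last entry of α is at most every entry of β below l, subtracting it from both shortens
    -- α, and the outer induction applies for every l ≤ k.
    have large : ∀ (l : ℕ) (α β : ℕ → ℝ), l ≤ k → k + 1 ≤ n - 1 → Antitone α → Antitone β → β ≤ α →
        (∀ i, k + 1 ≤ i → α i = 0) → (∀ i, l ≤ i → β i = 0) → (∀ i < l, α k ≤ β i) →
        profile ⟨0, by omega⟩ α β t ∈ closure (symEntropyRegion b (partitionOneRest n hn)) := by
      intro l α β hl hk hα hβ hβα h0 h0' hc
      have hnn : 0 ≤ α k := (h0 (k + 1) le_rfl).symm.le.trans (hα (Nat.le_succ k))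
      refine profile_mem_closure_of_sub_stepSeq hb hn (hl.trans (Nat.le_succ k)) hk hnn
        (ihk l _ _ hl (by omega) (antitone_sub_stepSeq hα h0 (le_head hα))
          (antitone_sub_stepSeq hβ h0' hc)
          (sub_stepSeq_le_sub_stepSeq hβα (hl.trans (Nat.le_succ k)) (le_head hα) h0')
          (fun i hi => sub_stepSeq_eq_zero h0 hi) fun i hi => ?_)
      simp [stepSeq, h0' i hi, Nat.not_lt.2 hi]
    intro l
    induction l with
    | zero =>
      intro α β _ hk hα hβ hβα h0 h0'
      exact large 0 α β (Nat.zero_le _) hk hα hβ hβα h0 h0' (by simp)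
    | succ l ihl =>
      intro α β hl hk hα hβ hβα h0 h0'
      -- The step height is the smaller of the two last entries. If it is that of β, then β is
      -- shortened and the inner induction applies.
      by_cases hc : β l ≤ α k
      · have hnn : 0 ≤ β l := (h0' (l + 1) le_rfl).symm.le.trans (hβ (Nat.le_succ l))
        have hcα : ∀ i < k + 1, β l ≤ α i := fun i hi => hc.trans (le_head hα i hi)
        refine profile_mem_closure_of_sub_stepSeq hb hn hl hk hnn
          (ihl _ _ ((Nat.le_succ l).trans hl) hk (antitone_sub_stepSeq hα h0 hcα)
            (antitone_sub_stepSeq hβ h0' (le_head hβ))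
            (sub_stepSeq_le_sub_stepSeq hβα hl hcα h0') (fun i hi => ?_)
            fun i hi => sub_stepSeq_eq_zero h0' hi)
        simp [stepSeq, h0 i hi, Nat.not_lt.2 hi]
      · have hlk : l + 1 ≤ k := by
          by_contra h
          obtain rfl : l = k := by omega
          exact hc (hβα l)
        exact large (l + 1) α β hlk hk hα hβ hβα h0 h0'
          fun i hi => (not_le.1 hc).le.trans (le_head hβ i hi)

/-! ### From polymatroids to increments -/

/-- The increments, for `i < m`, of a sequence. -/
def increments (m : ℕ) (a : ℕ → ℝ) : ℕ → ℝ := fun i => if i < m then a (i + 1) - a i else 0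

theorem sum_range_increments {m j : ℕ} (hj : j ≤ m) (a : ℕ → ℝ) :
    ∑ i ∈ Finset.range j, increments m a i = a j - a 0 := by
  rw [← Finset.sum_range_sub]
  refine Finset.sum_congr rfl fun i hi => ?_
  simp [increments, (Finset.mem_range.1 hi).trans_le hj]

/-- Concavity gives the decrease below m; monotonicity is needed only at the cut-off, where the
increments drop to zero. -/
theorem antitone_increments {m : ℕ} {a : ℕ → ℝ} (hmono : ∀ i < m, a i ≤ a (i + 1))
    (hconc : ∀ i, i + 2 ≤ m → a i + a (i + 2) ≤ 2 * a (i + 1)) : Antitone (increments m a) := by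
  refine antitone_nat_of_succ_le fun i => ?_
  unfold increments
  by_cases h : i + 1 < m
  · simp only [h, Nat.lt_of_succ_lt h, if_true]
    linarith [hconc i h]
  · by_cases h' : i < m
    · simp only [h, h', if_true, if_false]
      linarith [hmono i h']
    · simp [h, h']

/-- The set of the indices `1, …, j`. -/
def initialSet (n j : ℕ) : Finset (Fin n) := Finset.univ.filter fun i => 0 < i.val ∧ i.val ≤ j

theorem card_initialSet {n j : ℕ} (hj : j ≤ n - 1) : (initialSet n j).card = j := by
  rw [← Finset.card_map Fin.valEmbedding]
  have : (initialSet n j).map Fin.valEmbedding = Finset.Ioc 0 j := by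
    ext t
    simp only [initialSet, Finset.mem_map, Finset.mem_filter, Finset.mem_univ, true_and,
      Fin.valEmbedding_apply, Finset.mem_Ioc]
    exact ⟨by rintro ⟨i, h, rfl⟩; exact h, fun h => ⟨⟨t, by omega⟩, h, rfl⟩⟩
  simp [this]

theorem symPolymatroidRegion_subset_closure {b : ℝ} (hb : 1 < b) {n : ℕ} (hn : 2 ≤ n) :
    symPolymatroidRegion (partitionOneRest n hn) ⊆
      closure (symEntropyRegion b (partitionOneRest n hn)) := by
  rintro h ⟨⟨h0, hmono, hsub⟩, hsym⟩
  replace hsym := (mem_symSubspace_partitionOneRest_iff hn h).1 hsym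
  set z : Fin n := ⟨0, by omega⟩ with hz
  have hzI : ∀ j, z ∉ initialSet n j := fun j => by simp [initialSet, hz]
  have hI : ∀ {i j}, i ≤ j → initialSet n i ⊆ initialSet n j := fun hij k hk => by
    simp only [initialSet, Finset.mem_filter] at hk ⊢
    exact ⟨hk.1, hk.2.1, hk.2.2.trans hij⟩
  set a : ℕ → ℝ := fun j => h (initialSet n j) with ha
  set c : ℕ → ℝ := fun j => h (insert z (initialSet n j)) with hc
  have ha_eq : ∀ A : Finset (Fin n), z ∉ A → A.card ≤ n - 1 → h A = a A.card := fun A hA hle =>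
    hsym A _ (by simp [hA, hzI]) (by
      rw [Finset.erase_eq_of_notMem hA, Finset.erase_eq_of_notMem (hzI _), card_initialSet hle])
  have hc_eq : ∀ A : Finset (Fin n), z ∉ A → A.card ≤ n - 1 → h (insert z A) = c A.card :=
    fun A hA hle => hsym _ _ (by simp) (by
      rw [Finset.erase_insert hA, Finset.erase_insert (hzI _), card_initialSet hle])
  have hcard_le : ∀ A : Finset (Fin n), z ∉ A → A.card ≤ n - 1 := fun A hA => by
    have := Finset.card_le_card (Finset.subset_univ (insert z A))
    rw [Finset.card_insert_of_notMem hA, Finset.card_univ, Fintype.card_fin] at this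
    omega
  have exch : ∀ i, i + 2 ≤ n - 1 → ∃ B : Finset (Fin n), z ∉ B ∧ B.card = i + 1 ∧
      initialSet n (i + 1) ∩ B = initialSet n i ∧ initialSet n (i + 1) ∪ B = initialSet n (i + 2) := by
    intro i hi
    have hx : (⟨i + 2, by omega⟩ : Fin n) ∉ initialSet n i := by simp [initialSet]
    -- Exchanging i + 1 for i + 2 gives a set of the same size; submodularity for the two sets is
    -- then concavity in the size.
    refine ⟨insert ⟨i + 2, by omega⟩ (initialSet n i), ?_, ?_, ?_, ?_⟩
    · rw [Finset.mem_insert, not_or]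
      exact ⟨by simp [hz], hzI i⟩
    · rw [Finset.card_insert_of_notMem hx, card_initialSet (by omega)]
    · ext k
      simp only [initialSet, Finset.mem_inter, Finset.mem_insert, Finset.mem_filter,
        Finset.mem_univ, true_and, Fin.ext_iff]
      omega
    · ext k
      simp only [initialSet, Finset.mem_union, Finset.mem_insert, Finset.mem_filter,
        Finset.mem_univ, true_and, Fin.ext_iff]
      omega
  have aconc : ∀ i, i + 2 ≤ n - 1 → a i + a (i + 2) ≤ 2 * a (i + 1) := by
    intro i hi
    obtain ⟨B, hB, hBc, hcap, hcup⟩ := exch i hi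
    have := hsub (initialSet n (i + 1)) B
    rw [hcap, hcup, ha_eq B hB (hcard_le B hB), hBc] at this
    simp only [ha] at this ⊢
    linarith
  have cconc : ∀ i, i + 2 ≤ n - 1 → c i + c (i + 2) ≤ 2 * c (i + 1) := by
    intro i hi
    obtain ⟨B, hB, hBc, hcap, hcup⟩ := exch i hi
    have := hsub (insert z (initialSet n (i + 1))) (insert z B)
    rw [← Finset.insert_inter_distrib, ← Finset.insert_union_distrib, hcap, hcup,
      hc_eq B hB (hcard_le B hB), hBc] at this
    simp only [hc] at this ⊢
    linarith
  have hle : increments (n - 1) c ≤ increments (n - 1) a := by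
    intro i
    unfold increments
    split_ifs with hi
    -- Submodularity across `z`: adding element i + 1 gains no more in the presence of `z` than
    -- without it.
    · have := hsub (initialSet n (i + 1)) (insert z (initialSet n i))
      rw [Finset.inter_insert_of_notMem (hzI _), Finset.inter_eq_right.2 (hI (Nat.le_succ i)),
        Finset.union_insert, Finset.union_eq_left.2 (hI (Nat.le_succ i))] at this
      simp only [ha, hc] at this ⊢
      linarith
    · exact le_rfl
  have key := profile_mem_closure hb hn (t := c (n - 1) - a (n - 1))
    (sub_nonneg.2 (hmono _ _ (Finset.subset_insert _ _))) (n - 1) (n - 1) (increments (n - 1) a)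
    (increments (n - 1) c) le_rfl le_rfl
    (antitone_increments (fun i _ => hmono _ _ (hI (Nat.le_succ i))) aconc)
    (antitone_increments
      (fun i _ => hmono _ _ (Finset.insert_subset_insert z (hI (Nat.le_succ i)))) cconc) hle
    (fun i hi => by simp [increments, Nat.not_lt.2 hi])
    (fun i hi => by simp [increments, Nat.not_lt.2 hi])
  have ha0 : a 0 = 0 := by
    have := ha_eq ∅ (Finset.notMem_empty z) (Nat.zero_le _)
    rw [h0, Finset.card_empty] at this
    exact this.symm
  rw [← hz] at key
  convert key using 1
  funext A
  have hzA : z ∉ A.erase z := Finset.notMem_erase z A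
  have hj := hcard_le _ hzA
  by_cases hA : z ∈ A
  · have hh := hc_eq _ hzA hj
    rw [Finset.insert_erase hA] at hh
    simp only [profile, if_pos hA, Finset.sum_sub_distrib, sum_range_increments le_rfl,
      sum_range_increments hj, hh]
    linarith
  · have hh := ha_eq _ hzA hj
    rw [Finset.erase_eq_of_notMem hA] at hh
    rw [Finset.erase_eq_of_notMem hA] at hj
    simp only [profile, if_neg hA, Finset.erase_eq_of_notMem hA, sum_range_increments hj, hh]
    linarith

end PartSymEntropy

theorem mainTheorem4 (b : ℝ) (hb : 1 < b) (n : ℕ) (hn : 2 ≤ n) :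
    PartSymEntropy.symPolymatroidRegion (PartSymEntropy.partitionOneRest n hn) =
        closure (PartSymEntropy.entropyRegion b n) ∩
          (PartSymEntropy.symSubspace (PartSymEntropy.partitionOneRest n hn) :
            Set (PartSymEntropy.EntropySpace n)) ∧
      closure (PartSymEntropy.symEntropyRegion b (PartSymEntropy.partitionOneRest n hn)) =
        PartSymEntropy.symPolymatroidRegion (PartSymEntropy.partitionOneRest n hn) := by
  -- `h₁`, `h₃` and `h₄` are the three inclusions of the cycle.
  have h₁ := PartSymEntropy.symPolymatroidRegion_subset_closure hb hn
  have h₂ : closure (PartSymEntropy.entropyRegion b n) ⊆ PartSymEntropy.polymatroidRegion n :=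
    closure_minimal (PartSymEntropy.entropyRegion_subset_polymatroidRegion hb n)
      (PartSymEntropy.isClosed_polymatroidRegion n)
  have h₃ : closure (PartSymEntropy.symEntropyRegion b (PartSymEntropy.partitionOneRest n hn)) ⊆
      closure (PartSymEntropy.entropyRegion b n) ∩
        (PartSymEntropy.symSubspace (PartSymEntropy.partitionOneRest n hn) :
          Set (PartSymEntropy.EntropySpace n)) :=
    Set.subset_inter (closure_mono Set.inter_subset_left)
      (closure_minimal Set.inter_subset_right (PartSymEntropy.isClosed_symSubspace _))
  have h₄ := Set.inter_subset_inter_left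
    (PartSymEntropy.symSubspace (PartSymEntropy.partitionOneRest n hn) :
      Set (PartSymEntropy.EntropySpace n)) h₂
  exact ⟨(h₁.trans h₃).antisymm h₄, (h₃.trans h₄).antisymm h₁⟩
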